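/- Let $\mathbb{D}=\{x\in\mathbb{R}^2:|x|<1\}$, let $0<b<1$, and on $\mathbb{D}\setminus\{0\}$ consider the Randers metric $F=\alpha+\beta$, where $$\alpha=\frac{2\sqrt{(dx^1)^2+(dx^2)^2}}{1-(x^1)^2-(x^2)^2},\qquad \beta=b\,\frac{x^1dx^1+x^2dx^2}{(1-(x^1)^2-(x^2)^2)\sqrt{(x^1)^2+(x^2)^2}}$$ ($\beta$ is not defined at the origin). For $x \in \mathbb{D}\setminus\{0\}$ and linearly independent $y,v\in\mathbb{R}^2$, let $K(x,y,v)$ be the flag curvature of $F$ at $x$ with flagpole $y$ and transverse edge $v$, $$K(x,y,v)=\frac{g_y(R_y(v),v)}{g_y(y,y)\,g_y(v,v)-g_y(y,v)^2},$$ where $g_y$ is the inner product with matrix $g_{ij}(x,y)=\tfrac12\,\partial^2F^2/\partial y^i\partial y^j$ and $R_y$ is the Riemann curvature of $F$, i.e. $R_y(v)=R^i{}_k(x,y)v^k\,\partial/\partial x^i$ with $$R^i{}_k=2\frac{\partial G^i}{\partial x^k}-y^j\frac{\partial^2G^i}{\partial x^j\partial y^k}+2G^j\frac{\partial^2G^i}{\partial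 y^j\partial y^k}-\frac{\partial G^i}{\partial y^j}\frac{\partial G^j}{\partial y^k},\qquad G^i=\tfrac14 g^{il}\Big(\frac{\partial^2F^2}{\partial x^k\partial y^l}y^k-\frac{\partial F^2}{\partial x^l}\Big).$$ Then $F$ does not have constant negative flag curvature on $\mathbb{D}\setminus\{0\}$: there is no real number $K_0<0$ such that $K(x,y,v)=K_0$ for all $x\in\mathbb{D}\setminus\{0\}$ and all linearly independent $y,v\in\mathbb{R}^2$. -/

import Mathlib

noncomputable section

namespace Finsler

/-- A function on the tangent bundle of (an open subset of) `ℝⁿ`, in the standard coordinates: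
`Φ x y` is its value at the tangent vector `y` with base point `x`. -/
abbrev TangentFun (n : ℕ) : Type := (Fin n → ℝ) → (Fin n → ℝ) → ℝ

variable {n : ℕ}

/-- The partial derivative `∂Φ/∂xⁱ` in the position variable. -/
def dX (i : Fin n) (Φ : TangentFun n) : TangentFun n :=
  fun x y => lineDeriv ℝ (fun z => Φ z y) x (Pi.single i 1)

/-- The partial derivative `∂Φ/∂yⁱ` in the fibre variable. -/
def dY (i : Fin n) (Φ : TangentFun n) : TangentFun n :=
  fun x y => lineDeriv ℝ (fun w => Φ x w) y (Pi.single i 1)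

/-- The function `F²`. -/
def energy (F : TangentFun n) : TangentFun n := fun x y => F x y ^ 2

/-- The fundamental tensor `g_ij = (1/2) ∂²F²/∂yⁱ∂yʲ`. -/
def fundamentalTensor (F : TangentFun n) (x y : Fin n → ℝ) : Matrix (Fin n) (Fin n) ℝ :=
  Matrix.of fun i j => (1 / 2) * dY i (dY j (energy F)) x y

/-- The spray coefficients
`Gⁱ = (1/4) gⁱˡ ((∂²F²/∂xᵏ∂yˡ) yᵏ - ∂F²/∂xˡ)`. -/
def sprayCoeff (F : TangentFun n) (i : Fin n) : TangentFun n := fun x y =>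
  (1 / 4) * ∑ l, (fundamentalTensor F x y)⁻¹ i l *
    ((∑ k, dX k (dY l (energy F)) x y * y k) - dX l (energy F) x y)

/-- The Riemann curvature
`Rⁱ_k = 2 ∂Gⁱ/∂xᵏ - yʲ ∂²Gⁱ/∂xʲ∂yᵏ + 2 Gʲ ∂²Gⁱ/∂yʲ∂yᵏ - (∂Gⁱ/∂yʲ)(∂Gʲ/∂yᵏ)`. -/
def riemannCurvature (F : TangentFun n) (i k : Fin n) : TangentFun n := fun x y =>
  2 * dX k (sprayCoeff F i) x y
    - ∑ j, y j * dX j (dY k (sprayCoeff F i)) x y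
    + 2 * ∑ j, sprayCoeff F j x y * dY j (dY k (sprayCoeff F i)) x y
    - ∑ j, dY j (sprayCoeff F i) x y * dY k (sprayCoeff F j) x y

/-- The inner product `g_y(u, v) = g_ij(x, y) uⁱ vʲ`. -/
def fundamentalForm (F : TangentFun n) (x y u v : Fin n → ℝ) : ℝ :=
  ∑ i, ∑ j, fundamentalTensor F x y i j * u i * v j

/-- The flag curvature
`K(x, y, v) = g_y(R_y(v), v) / (g_y(y, y) g_y(v, v) - g_y(y, v)²)`
of the flag spanned by `y` and `v`, with flagpole `y`; it is meaningful when `y` and `v` are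
linearly independent. -/
def flagCurvature (F : TangentFun n) (x y v : Fin n → ℝ) : ℝ :=
  fundamentalForm F x y (fun i => ∑ k, riemannCurvature F i k x y * v k) v /
    (fundamentalForm F x y y y * fundamentalForm F x y v v - fundamentalForm F x y y v ^ 2)

/-- The metric `F` has constant flag curvature `K` on `U`: all flags at all points of `U` have
flag curvature `K`. -/
def HasConstantFlagCurvature (F : TangentFun n) (U : Set (Fin n → ℝ)) (K : ℝ) : Prop :=
  ∀ x ∈ U, ∀ y v : Fin n → ℝ, LinearIndependent ℝ ![y, v] → flagCurvature F x y v = K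

end Finsler

namespace RandersPoincare

/-- The open unit disc without its centre. The one-form `betaForm b` is singular at the centre, so
this is where the Randers Poincaré metric is defined. -/
def puncturedDisc : Set (Fin 2 → ℝ) := {x | x 0 ^ 2 + x 1 ^ 2 < 1 ∧ x ≠ 0}

/-- The Poincaré metric `α(x, y) = 2 |y| / (1 - |x|²)`. -/
def alpha (x y : Fin 2 → ℝ) : ℝ :=
  2 * √(y 0 ^ 2 + y 1 ^ 2) / (1 - x 0 ^ 2 - x 1 ^ 2)

/-- The one-form `β(x, y) = b ⟨x, y⟩ / ((1 - |x|²) |x|)`. -/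
def betaForm (b : ℝ) (x y : Fin 2 → ℝ) : ℝ :=
  b * ((x 0 * y 0 + x 1 * y 1) / ((1 - x 0 ^ 2 - x 1 ^ 2) * √(x 0 ^ 2 + x 1 ^ 2)))

/-- The Randers Poincaré metric `F = α + β`. -/
def metric (b : ℝ) : Finsler.TangentFun 2 := fun x y => alpha x y + betaForm b x y

end RandersPoincare

end

open Finsler

noncomputable section

namespace Finsler

variable {n : ℕ}

/-! With `ρ` the hyperbolic distance to the centre, `β = (b/2) dρ` is closed, so `F` is projectively
equivalent to `α`: its spray is the Poincaré spray plus `P y`, where `P = β_{i|j} yⁱ yʲ / (2F)` and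
the bar denotes the covariant derivative of `α`. The Hessian of `ρ` vanishes in the radial
direction, so `P` contains the square of `x ∧ y = x 0 * y 1 - x 1 * y 0`.

Take `x` on the positive first axis, `y` radial and `v = e₁` (indices 0, 1). Then `P` contributes
nothing to `R¹₁`, which keeps its Poincaré value `-α²`, while `g` is diagonal and `g_y(y, y) = F²`.
Hence the flag curvature is `-(α/F)²`, that is `-4/(2 + b)²` outward and `-4/(2 - b)²` inward. These
differ because `b > 0`.

The spray is found in `sprayCoeff_metric`, the curvature in `riemannCurvature_radial` and
`flagCurvature_radial`. -/

theorem dX_congr {U : Set (Fin n → ℝ)} (hU : IsOpen U) {Φ Ψ : TangentFun n} {x y : Fin n → ℝ}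
    (i : Fin n) (hx : x ∈ U)
    (h : ∀ t : ℝ, x + t • Pi.single i 1 ∈ U →
      Φ (x + t • Pi.single i 1) y = Ψ (x + t • Pi.single i 1) y) :
    dX i Φ x y = dX i Ψ x y := by
  refine Filter.EventuallyEq.deriv_eq ?_
  have hc : Continuous fun t : ℝ => x + t • (Pi.single i 1 : Fin n → ℝ) := by fun_prop
  filter_upwards [(hU.preimage hc).mem_nhds (x := 0) (by simpa using hx)] with t ht using h t ht

/-- As in `dX_congr`, agreement is needed only on one coordinate line, so formulas valid just for `x
1 = y 1 = 0` can still be differentiated in direction 0. -/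
theorem dY_congr {V : Set (Fin n → ℝ)} (hV : IsOpen V) {Φ Ψ : TangentFun n} {x y : Fin n → ℝ}
    (i : Fin n) (hy : y ∈ V)
    (h : ∀ t : ℝ, y + t • Pi.single i 1 ∈ V →
      Φ x (y + t • Pi.single i 1) = Ψ x (y + t • Pi.single i 1)) :
    dY i Φ x y = dY i Ψ x y := by
  refine Filter.EventuallyEq.deriv_eq ?_
  have hc : Continuous fun t : ℝ => y + t • (Pi.single i 1 : Fin n → ℝ) := by fun_prop
  filter_upwards [(hV.preimage hc).mem_nhds (x := 0) (by simpa using hy)] with t ht using h t ht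

end Finsler

/-- The Euclidean dot product on `ℝ²`, in coordinates. -/
def dot (x y : Fin 2 → ℝ) : ℝ := x 0 * y 0 + x 1 * y 1

/-- The Euclidean norm on `ℝ²`, in coordinates. -/
def nrm (x : Fin 2 → ℝ) : ℝ := √(x 0 ^ 2 + x 1 ^ 2)

theorem nrm_sq (x : Fin 2 → ℝ) : nrm x ^ 2 = x 0 ^ 2 + x 1 ^ 2 :=
  Real.sq_sqrt (by positivity)

theorem nrm_nonneg (x : Fin 2 → ℝ) : 0 ≤ nrm x := Real.sqrt_nonneg _

theorem sq_add_sq_pos {x : Fin 2 → ℝ} (hx : x ≠ 0) : 0 < x 0 ^ 2 + x 1 ^ 2 := by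
  by_contra h
  apply hx
  have h0 : x 0 = 0 := by nlinarith [sq_nonneg (x 0), sq_nonneg (x 1)]
  have h1 : x 1 = 0 := by nlinarith [sq_nonneg (x 0), sq_nonneg (x 1)]
  ext i; fin_cases i <;> simp [h0, h1]

theorem nrm_pos {x : Fin 2 → ℝ} (hx : x ≠ 0) : 0 < nrm x :=
  Real.sqrt_pos.2 (sq_add_sq_pos hx)

theorem abs_dot_le (x y : Fin 2 → ℝ) : |dot x y| ≤ nrm x * nrm y := by
  refine abs_le_of_sq_le_sq ?_ (mul_nonneg (nrm_nonneg x) (nrm_nonneg y))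
  rw [mul_pow, nrm_sq, nrm_sq, dot]
  nlinarith [sq_nonneg (x 0 * y 1 - x 1 * y 0)]

/-! ### Directional derivatives of Euclidean expressions. -/

theorem hasLineDerivAt_coord (x v : Fin 2 → ℝ) (i : Fin 2) :
    HasLineDerivAt ℝ (fun z : Fin 2 → ℝ => z i) (v i) x v := by
  have := ((hasDerivAt_id (0 : ℝ)).mul_const (v i)).const_add (x i)
  simpa [HasLineDerivAt] using this

theorem hasLineDerivAt_dot (a x v : Fin 2 → ℝ) :
    HasLineDerivAt ℝ (fun z => dot z a) (dot v a) x v :=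
  HasDerivAt.add (HasDerivAt.mul_const (hasLineDerivAt_coord x v 0) (a 0))
    (HasDerivAt.mul_const (hasLineDerivAt_coord x v 1) (a 1))

theorem dot_comm (x y : Fin 2 → ℝ) : dot x y = dot y x := by
  simp only [dot]; ring

theorem hasLineDerivAt_sq_add_sq (x v : Fin 2 → ℝ) :
    HasLineDerivAt ℝ (fun z : Fin 2 → ℝ => z 0 ^ 2 + z 1 ^ 2) (2 * dot x v) x v := by
  have := HasDerivAt.add (HasDerivAt.pow (hasLineDerivAt_coord x v 0) 2)
    (HasDerivAt.pow (hasLineDerivAt_coord x v 1) 2)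
  refine HasDerivAt.congr_deriv this ?_
  simp [dot]; ring

theorem hasLineDerivAt_nrm {x : Fin 2 → ℝ} (hx : x ≠ 0) (v : Fin 2 → ℝ) :
    HasLineDerivAt ℝ nrm (dot x v / nrm x) x v := by
  have := HasDerivAt.sqrt (hasLineDerivAt_sq_add_sq x v)
    (by simpa using (sq_add_sq_pos hx).ne')
  refine HasDerivAt.congr_deriv this ?_
  simp only [nrm, zero_smul, add_zero]
  rw [mul_div_mul_left _ _ two_ne_zero]

namespace RandersPoincare

/-! ### Derivatives and positivity of the metric. -/

theorem isOpen_puncturedDisc : IsOpen puncturedDisc := by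
  have h : Continuous fun x : Fin 2 → ℝ => x 0 ^ 2 + x 1 ^ 2 := by fun_prop
  exact (isOpen_lt h continuous_const).inter isOpen_ne

/-- The conformal factor `1 - |x|²`. -/
def conf (x : Fin 2 → ℝ) : ℝ := 1 - (x 0 ^ 2 + x 1 ^ 2)

theorem conf_pos {x : Fin 2 → ℝ} (hx : x ∈ puncturedDisc) : 0 < conf x := by
  have := hx.1
  simp only [conf]; linarith

theorem hasLineDerivAt_conf (x v : Fin 2 → ℝ) :
    HasLineDerivAt ℝ conf (-(2 * dot x v)) x v :=
  HasDerivAt.const_sub 1 (hasLineDerivAt_sq_add_sq x v)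

theorem metric_eq (b : ℝ) (x y : Fin 2 → ℝ) :
    metric b x y = (2 * nrm y + b * (dot x y / nrm x)) / conf x := by
  simp only [metric, alpha, betaForm, nrm, dot, conf, ← sub_sub]
  rw [mul_comm (1 - x 0 ^ 2 - x 1 ^ 2) √(x 0 ^ 2 + x 1 ^ 2), ← div_div]
  ring

/-- The directional derivative of the metric in the fibre variable. -/
def metricY (b : ℝ) (x y v : Fin 2 → ℝ) : ℝ :=
  (2 * (dot y v / nrm y) + b * (dot x v / nrm x)) / conf x

/-- The directional derivative of the metric in the position variable. -/
def metricX (b : ℝ) (x y v : Fin 2 → ℝ) : ℝ :=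
  b * (dot v y / nrm x - dot x y * dot x v / nrm x ^ 3) / conf x
    + 2 * dot x v * (2 * nrm y + b * (dot x y / nrm x)) / conf x ^ 2

/-- The second directional derivative of the metric in the fibre variable. -/
def metricYY (x y v w : Fin 2 → ℝ) : ℝ :=
  2 * (dot w v / nrm y - dot y v * dot y w / nrm y ^ 3) / conf x

/-- The mixed directional derivative: `v` in the fibre and `w` in the position variable. -/
def metricXY (b : ℝ) (x y v w : Fin 2 → ℝ) : ℝ :=
  b * (dot w v / nrm x - dot x v * dot x w / nrm x ^ 3) / conf x
    + 2 * dot x w * (2 * (dot y v / nrm y) + b * (dot x v / nrm x)) / conf x ^ 2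

theorem hasLineDerivAt_dot_div_nrm {x : Fin 2 → ℝ} (hx : x ≠ 0) (a v : Fin 2 → ℝ) :
    HasLineDerivAt ℝ (fun z => dot z a / nrm z)
      (dot v a / nrm x - dot x a * dot x v / nrm x ^ 3) x v := by
  have h := (nrm_pos hx).ne'
  have := HasDerivAt.div (hasLineDerivAt_dot a x v) (hasLineDerivAt_nrm hx v) (by simpa using h)
  refine HasDerivAt.congr_deriv this ?_
  simp only [zero_smul, add_zero]
  field_simp

/-- The derivative of `z ↦ (c + b ⟨z, a⟩ / |z|) / (1 - |z|²)`. -/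
theorem hasLineDerivAt_position (b c : ℝ) {x : Fin 2 → ℝ} (hx : x ∈ puncturedDisc)
    (a v : Fin 2 → ℝ) :
    HasLineDerivAt ℝ (fun z => (c + b * (dot z a / nrm z)) / conf z)
      (b * (dot v a / nrm x - dot x a * dot x v / nrm x ^ 3) / conf x
        + 2 * dot x v * (c + b * (dot x a / nrm x)) / conf x ^ 2) x v := by
  have h := (conf_pos hx).ne'
  have := HasDerivAt.div
    (HasDerivAt.const_add c (HasDerivAt.const_mul b (hasLineDerivAt_dot_div_nrm hx.2 a v)))
    (hasLineDerivAt_conf x v) (by simpa using h)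
  refine HasDerivAt.congr_deriv this ?_
  simp only [zero_smul, add_zero]
  generalize dot v a / nrm x - dot x a * dot x v / nrm x ^ 3 = q
  generalize dot x a / nrm x = q'
  field_simp
  ring

theorem hasLineDerivAt_metric_left (b : ℝ) {x : Fin 2 → ℝ} (hx : x ∈ puncturedDisc)
    (y v : Fin 2 → ℝ) :
    HasLineDerivAt ℝ (fun z => metric b z y) (metricX b x y v) x v := by
  simp only [metric_eq]
  exact hasLineDerivAt_position b _ hx y v

theorem hasLineDerivAt_metricY_left (b : ℝ) {x : Fin 2 → ℝ} (hx : x ∈ puncturedDisc)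
    (y v w : Fin 2 → ℝ) :
    HasLineDerivAt ℝ (fun z => metricY b z y v) (metricXY b x y v w) x w :=
  hasLineDerivAt_position b _ hx v w

theorem hasLineDerivAt_metric_right (b : ℝ) (x : Fin 2 → ℝ) {y : Fin 2 → ℝ} (hy : y ≠ 0)
    (v : Fin 2 → ℝ) :
    HasLineDerivAt ℝ (fun w => metric b x w) (metricY b x y v) y v := by
  simp only [metric_eq, dot_comm x, metricY]
  exact HasDerivAt.div_const (HasDerivAt.add (HasDerivAt.const_mul 2 (hasLineDerivAt_nrm hy v))
    (HasDerivAt.const_mul b (HasDerivAt.div_const (hasLineDerivAt_dot x y v) _))) _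

theorem hasLineDerivAt_metricY_right (b : ℝ) (x : Fin 2 → ℝ) {y : Fin 2 → ℝ} (hy : y ≠ 0)
    (v w : Fin 2 → ℝ) :
    HasLineDerivAt ℝ (fun z => metricY b x z v) (metricYY x y v w) y w :=
  HasDerivAt.div_const (HasDerivAt.add_const _
    (HasDerivAt.const_mul 2 (hasLineDerivAt_dot_div_nrm hy v w))) _

/-- By Cauchy–Schwarz, `|β| ≤ (b/2) α < α`. -/
theorem metric_pos {b : ℝ} (hb0 : 0 < b) (hb1 : b < 1) {x y : Fin 2 → ℝ}
    (hx : x ∈ puncturedDisc) (hy : y ≠ 0) : 0 < metric b x y := by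
  rw [metric_eq]
  have hr := nrm_pos hx.2
  have hm := nrm_pos hy
  refine div_pos ?_ (conf_pos hx)
  have h : -nrm y ≤ dot x y / nrm x := by
    rw [le_div_iff₀ hr]
    linarith [(abs_le.1 (abs_dot_le x y)).1, mul_comm (nrm x) (nrm y)]
  nlinarith

local notation "𝐞" => fun i : Fin 2 => (Pi.single i (1 : ℝ) : Fin 2 → ℝ)

/-! ### Derivatives of `F²` and the fundamental tensor. -/

theorem dX_energy (b : ℝ) {x : Fin 2 → ℝ} (hx : x ∈ puncturedDisc) (y : Fin 2 → ℝ) (i : Fin 2) :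
    dX i (energy (metric b)) x y = 2 * (metric b x y * metricX b x y (𝐞 i)) := by
  have := HasDerivAt.pow (hasLineDerivAt_metric_left b hx y (𝐞 i)) 2
  refine (HasLineDerivAt.lineDeriv (HasDerivAt.congr_deriv this ?_))
  simp; ring

theorem dY_energy (b : ℝ) (x : Fin 2 → ℝ) {y : Fin 2 → ℝ} (hy : y ≠ 0) (i : Fin 2) :
    dY i (energy (metric b)) x y = 2 * (metric b x y * metricY b x y (𝐞 i)) := by
  have := HasDerivAt.pow (hasLineDerivAt_metric_right b x hy (𝐞 i)) 2
  refine (HasLineDerivAt.lineDeriv (HasDerivAt.congr_deriv this ?_))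
  simp; ring

theorem fundamentalTensor_metric (b : ℝ) (x : Fin 2 → ℝ) {y : Fin 2 → ℝ} (hy : y ≠ 0)
    (i j : Fin 2) :
    fundamentalTensor (metric b) x y i j =
      metricY b x y (𝐞 i) * metricY b x y (𝐞 j) + metric b x y * metricYY x y (𝐞 j) (𝐞 i) := by
  have h : dY i (dY j (energy (metric b))) x y =
      2 * (metricY b x y (𝐞 i) * metricY b x y (𝐞 j)
        + metric b x y * metricYY x y (𝐞 j) (𝐞 i)) := by
    rw [dY_congr isOpen_ne i hy (Ψ := fun x y => 2 * (metric b x y * metricY b x y (𝐞 j)))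
      (fun _ ht => dY_energy b x ht j)]
    refine HasLineDerivAt.lineDeriv ?_
    have := HasDerivAt.const_mul 2 (HasDerivAt.mul (hasLineDerivAt_metric_right b x hy (𝐞 i))
      (hasLineDerivAt_metricY_right b x hy (𝐞 j) (𝐞 i)))
    refine HasDerivAt.congr_deriv this ?_
    simp
  simp only [fundamentalTensor, Matrix.of_apply, h]
  ring

theorem dX_dY_energy (b : ℝ) {x y : Fin 2 → ℝ} (hx : x ∈ puncturedDisc) (hy : y ≠ 0)
    (k l : Fin 2) :
    dX k (dY l (energy (metric b))) x y =
      2 * (metricX b x y (𝐞 k) * metricY b x y (𝐞 l)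
        + metric b x y * metricXY b x y (𝐞 l) (𝐞 k)) := by
  rw [dX_congr isOpen_puncturedDisc k hx
    (Ψ := fun x y => 2 * (metric b x y * metricY b x y (𝐞 l)))
    (fun _ _ => dY_energy b _ hy l)]
  refine HasLineDerivAt.lineDeriv ?_
  have := HasDerivAt.const_mul 2 (HasDerivAt.mul (hasLineDerivAt_metric_left b hx y (𝐞 k))
      (hasLineDerivAt_metricY_left b hx y (𝐞 l) (𝐞 k)))
  refine HasDerivAt.congr_deriv this ?_
  simp

/-! ### The spray of `F`. -/

/-- The projective factor relating the sprays of `F` and of the Poincaré metric. -/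
def projFactor (b : ℝ) (x y : Fin 2 → ℝ) : ℝ :=
  b * (1 + nrm x ^ 2) * (x 0 * y 1 - x 1 * y 0) ^ 2 / (2 * nrm x ^ 3 * conf x ^ 2 * metric b x y)

/-- The spray coefficients of the Poincaré metric. -/
def poincareSpray (x y : Fin 2 → ℝ) (i : Fin 2) : ℝ :=
  (2 * dot x y * y i - nrm y ^ 2 * x i) / conf x

/-- The fibre Hessian of `F` is a multiple `c` of `w ⊗ w` with `w = (-y 1, y 0)`. So `g = p ⊗ p + F
c (w ⊗ w)` with `p = F_y`, whose determinant is `F c (p · y)²`, and `p · y = F` by Euler. -/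
theorem det_fundamentalTensor_ne_zero {b : ℝ} (hb0 : 0 < b) (hb1 : b < 1) {x y : Fin 2 → ℝ}
    (hx : x ∈ puncturedDisc) (hy : y ≠ 0) :
    (fundamentalTensor (metric b) x y).det ≠ 0 := by
  have hF := metric_pos hb0 hb1 hx hy
  have hm := nrm_pos hy
  have hp := conf_pos hx
  have key : (fundamentalTensor (metric b) x y).det =
      2 * metric b x y ^ 3 / (conf x * nrm y ^ 3) := by
    have hE : metric b x y = metricY b x y (𝐞 0) * y 0 + metricY b x y (𝐞 1) * y 1 := by
      rw [metric_eq]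
      simp only [metricY, dot, Pi.single_apply]
      simp
      have := nrm_sq y
      have hr := nrm_pos hx.2
      field_simp
      linear_combination (2 * nrm x) * this
    have hYY : ∀ i j : Fin 2, metricYY x y (𝐞 j) (𝐞 i) =
        2 / (conf x * nrm y ^ 3) * (![-y 1, y 0] i * ![-y 1, y 0] j) := by
      intro i j
      have := nrm_sq y
      fin_cases i <;> fin_cases j <;> simp [metricYY, dot] <;> field_simp <;>
        linear_combination this
    rw [Matrix.det_fin_two]
    simp only [fundamentalTensor_metric b x hy, hYY]
    simp only [Matrix.cons_val_zero, Matrix.cons_val_one]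
    generalize metricY b x y (𝐞 0) = p at *
    generalize metricY b x y (𝐞 1) = q at *
    have : 2 * metric b x y ^ 3 / (conf x * nrm y ^ 3) =
      2 / (conf x * nrm y ^ 3) * metric b x y * (p * y 0 + q * y 1) ^ 2 := by
      rw [← hE]; ring
    rw [this]
    ring
  rw [key]
  positivity

/-- The component of the spray equation along `F_y`. Since `F_y · y = F`, it is the equation that
determines `projFactor`. -/
theorem metricY_spray {b : ℝ} (hb0 : 0 < b) (hb1 : b < 1) {x y : Fin 2 → ℝ}
    (hx : x ∈ puncturedDisc) (hy : y ≠ 0) :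
    ∑ i, metricY b x y (𝐞 i) * (poincareSpray x y i + projFactor b x y * y i) =
      1 / 2 * ∑ k, metricX b x y (𝐞 k) * y k := by
  have hF := (metric_pos hb0 hb1 hx hy).ne'
  have hm := (nrm_pos hy).ne'
  have hr := (nrm_pos hx.2).ne'
  have hp := (conf_pos hx).ne'
  have h1 := nrm_sq y
  have h2 := nrm_sq x
  have h3 : conf x = 1 - nrm x ^ 2 := by rw [h2, conf]
  have hE : metricY b x y (𝐞 0) * y 0 + metricY b x y (𝐞 1) * y 1 = metric b x y := by
    rw [metric_eq]
    simp [metricY, dot]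
    field_simp
    linear_combination (-2 * nrm x) * h1
  have hG : metricY b x y (𝐞 0) * poincareSpray x y 0 + metricY b x y (𝐞 1) * poincareSpray x y 1
      = (2 * dot x y * nrm y + 2 * b * dot x y ^ 2 / nrm x - b * nrm y ^ 2 * nrm x)
        / conf x ^ 2 := by
    simp [metricY, poincareSpray, dot]
    field_simp
    linear_combination (-4 * nrm x * (x 0 * y 0 + x 1 * y 1)) * h1 + nrm y ^ 3 * b * h2
  have hX : metricX b x y (𝐞 0) * y 0 + metricX b x y (𝐞 1) * y 1 =
      b * (nrm y ^ 2 / nrm x - dot x y ^ 2 / nrm x ^ 3) / conf x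
        + 2 * dot x y * (2 * nrm y + b * (dot x y / nrm x)) / conf x ^ 2 := by
    rw [h1]
    simp [metricX, dot]
    ring
  have hP : projFactor b x y * metric b x y =
      b * (1 + nrm x ^ 2) * (nrm x ^ 2 * nrm y ^ 2 - dot x y ^ 2)
        / (2 * nrm x ^ 3 * conf x ^ 2) := by
    have : (x 0 * y 1 - x 1 * y 0) ^ 2 = nrm x ^ 2 * nrm y ^ 2 - dot x y ^ 2 := by
      rw [h1, h2, dot]; ring
    rw [projFactor, this]
    field_simp
  simp only [Fin.sum_univ_two]
  rw [hX]
  have : metricY b x y (𝐞 0) * (poincareSpray x y 0 + projFactor b x y * y 0) +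
      metricY b x y (𝐞 1) * (poincareSpray x y 1 + projFactor b x y * y 1) =
      (metricY b x y (𝐞 0) * poincareSpray x y 0 + metricY b x y (𝐞 1) * poincareSpray x y 1)
      + projFactor b x y * metric b x y := by
    rw [← hE]; ring
  rw [this, hG, hP]
  field_simp
  rw [h3]
  ring

/-- The component along `F_yy`. The projective term drops out because `F_yy y = 0`, and the terms in
`b` cancel because `β` is closed; what remains is the spray equation of `α`. -/
theorem metricYY_spray (b : ℝ) {x y : Fin 2 → ℝ} (hx : x ∈ puncturedDisc) (hy : y ≠ 0)
    (l : Fin 2) :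
    ∑ i, metricYY x y (𝐞 i) (𝐞 l) * (poincareSpray x y i + projFactor b x y * y i) =
      1 / 2 * ((∑ k, metricXY b x y (𝐞 l) (𝐞 k) * y k) - metricX b x y (𝐞 l)) := by
  have hm := (nrm_pos hy).ne'
  have hr := (nrm_pos hx.2).ne'
  have hp := (conf_pos hx).ne'
  have h1 := nrm_sq y
  have hE : ∑ i, metricYY x y (𝐞 i) (𝐞 l) * y i = 0 := by
    rw [Fin.sum_univ_two]
    fin_cases l <;> simp [metricYY, dot] <;> field_simp <;> rw [h1] <;> ring
  have : ∑ i, metricYY x y (𝐞 i) (𝐞 l) * (poincareSpray x y i + projFactor b x y * y i) =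
      ∑ i, metricYY x y (𝐞 i) (𝐞 l) * poincareSpray x y i := by
    rw [← add_zero (∑ i, metricYY x y (𝐞 i) (𝐞 l) * poincareSpray x y i),
      ← mul_zero (projFactor b x y), ← hE, Finset.mul_sum, ← Finset.sum_add_distrib]
    refine Finset.sum_congr rfl fun i _ => by ring
  rw [this]
  simp only [Fin.sum_univ_two]
  fin_cases l <;> simp [metricYY, metricXY, metricX, poincareSpray, dot] <;> field_simp
  · linear_combination (8 * nrm x ^ 3 * y 0 * (x 0 * y 0 + x 1 * y 1)) * h1
  · linear_combination (8 * nrm x ^ 3 * y 1 * (x 0 * y 0 + x 1 * y 1)) * h1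

theorem sprayCoeff_metric {b : ℝ} (hb0 : 0 < b) (hb1 : b < 1) {x y : Fin 2 → ℝ}
    (hx : x ∈ puncturedDisc) (hy : y ≠ 0) (i : Fin 2) :
    sprayCoeff (metric b) i x y = poincareSpray x y i + projFactor b x y * y i := by
  set G : Fin 2 → ℝ := fun i => poincareSpray x y i + projFactor b x y * y i with hG
  -- Since `g = F_y ⊗ F_y + F F_yy`, the defining linear system is a combination of the two
  -- preceding identities; inverting `g` then identifies the spray.
  have h : (fundamentalTensor (metric b) x y).mulVec ((4 : ℝ) • G) = fun l =>
      (∑ k, dX k (dY l (energy (metric b))) x y * y k) - dX l (energy (metric b)) x y := by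
    ext l
    have e1 := metricY_spray hb0 hb1 hx hy
    have e2 := metricYY_spray b hx hy l
    simp only [Matrix.mulVec, dotProduct, fundamentalTensor_metric b x hy,
      dX_dY_energy b hx hy, dX_energy b hx, Fin.sum_univ_two, Pi.smul_apply, smul_eq_mul] at *
    linear_combination 4 * metricY b x y (𝐞 l) * e1 + 4 * metric b x y * e2
  have h' := congrArg (fun u => (fundamentalTensor (metric b) x y)⁻¹.mulVec u i) h
  simp only [Matrix.mulVec_mulVec] at h'
  rw [Matrix.nonsing_inv_mul _ (isUnit_iff_ne_zero.2
    (det_fundamentalTensor_ne_zero hb0 hb1 hx hy)), Matrix.one_mulVec] at h'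
  simp only [Pi.smul_apply, smul_eq_mul, Matrix.mulVec, dotProduct] at h'
  rw [sprayCoeff, ← h']
  ring

/-! ### Spray and Riemann curvature in radial directions. -/

/-- Both `(x ∧ w)²` and `w 1` vanish at `w = y`, so the product has zero derivative there. -/
theorem hasLineDerivAt_projFactor_mul {b : ℝ} (hb0 : 0 < b) (hb1 : b < 1) {x y : Fin 2 → ℝ}
    (hx : x ∈ puncturedDisc) (hy : y ≠ 0) (hx1 : x 1 = 0) (hy1 : y 1 = 0) (v : Fin 2 → ℝ) :
    HasLineDerivAt ℝ (fun w => projFactor b x w * w 1) 0 y v := by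
  have hF := (metric_pos hb0 hb1 hx hy).ne'
  have hr := (nrm_pos hx.2).ne'
  have hp := (conf_pos hx).ne'
  have h1 := HasDerivAt.const_mul (b * (1 + nrm x ^ 2)) (HasDerivAt.pow (HasDerivAt.sub
    (HasDerivAt.const_mul (x 0) (hasLineDerivAt_coord y v 1))
    (HasDerivAt.const_mul (x 1) (hasLineDerivAt_coord y v 0))) 2)
  have h2 := HasDerivAt.const_mul (2 * nrm x ^ 3 * conf x ^ 2)
    (hasLineDerivAt_metric_right b x hy v)
  have h3 := HasDerivAt.mul (HasDerivAt.div h1 h2 (by simp [hF, hr, hp]))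
    (hasLineDerivAt_coord y v 1)
  refine HasDerivAt.congr_deriv h3 ?_
  simp [hx1, hy1]

theorem projFactor_radial (b : ℝ) {x y : Fin 2 → ℝ} (hx1 : x 1 = 0) (hy1 : y 1 = 0) :
    projFactor b x y = 0 := by
  simp [projFactor, hx1, hy1]

theorem nrm_sq_radial {x : Fin 2 → ℝ} (hx1 : x 1 = 0) : nrm x ^ 2 = x 0 ^ 2 := by
  simp [nrm_sq, hx1]

theorem sprayCoeff_zero_radial {b : ℝ} (hb0 : 0 < b) (hb1 : b < 1) {x y : Fin 2 → ℝ}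
    (hx : x ∈ puncturedDisc) (hy : y ≠ 0) (hx1 : x 1 = 0) (hy1 : y 1 = 0) :
    sprayCoeff (metric b) 0 x y = x 0 * y 0 ^ 2 / conf x := by
  rw [sprayCoeff_metric hb0 hb1 hx hy, projFactor_radial b hx1 hy1, poincareSpray,
    nrm_sq_radial hy1, dot, hx1, hy1]
  ring

theorem sprayCoeff_one_radial {b : ℝ} (hb0 : 0 < b) (hb1 : b < 1) {x y : Fin 2 → ℝ}
    (hx : x ∈ puncturedDisc) (hy : y ≠ 0) (hx1 : x 1 = 0) (hy1 : y 1 = 0) :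
    sprayCoeff (metric b) 1 x y = 0 := by
  rw [sprayCoeff_metric hb0 hb1 hx hy, projFactor_radial b hx1 hy1, poincareSpray, hx1, hy1]
  simp

theorem dY_one_sprayCoeff_one_radial {b : ℝ} (hb0 : 0 < b) (hb1 : b < 1) {x y : Fin 2 → ℝ}
    (hx : x ∈ puncturedDisc) (hy : y ≠ 0) (hx1 : x 1 = 0) (hy1 : y 1 = 0) :
    dY 1 (sprayCoeff (metric b) 1) x y = 2 * x 0 * y 0 / conf x := by
  rw [dY_congr isOpen_ne 1 hy
    (Ψ := fun x y => poincareSpray x y 1 + projFactor b x y * y 1)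
    (fun _ ht => sprayCoeff_metric hb0 hb1 hx ht 1)]
  refine HasLineDerivAt.lineDeriv ?_
  have h1 := HasDerivAt.div_const (HasDerivAt.sub
    (HasDerivAt.mul (HasDerivAt.const_mul 2 (hasLineDerivAt_dot x y (𝐞 1)))
      (hasLineDerivAt_coord y (𝐞 1) 1))
    (HasDerivAt.mul_const (HasDerivAt.pow (hasLineDerivAt_nrm hy (𝐞 1)) 2) (x 1))) (conf x)
  have h2 := HasDerivAt.add h1 (hasLineDerivAt_projFactor_mul hb0 hb1 hx hy hx1 hy1 (𝐞 1))
  simp only [poincareSpray, dot_comm x]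
  refine HasDerivAt.congr_deriv h2 ?_
  simp [hx1, hy1, dot]
  ring

theorem dY_zero_sprayCoeff_one_radial {b : ℝ} (hb0 : 0 < b) (hb1 : b < 1) {x y : Fin 2 → ℝ}
    (hx : x ∈ puncturedDisc) (hy : y ≠ 0) (hx1 : x 1 = 0) (hy1 : y 1 = 0) :
    dY 0 (sprayCoeff (metric b) 1) x y = 0 := by
  rw [dY_congr isOpen_ne 0 hy (Ψ := fun _ _ => 0)
    (fun _ ht => sprayCoeff_one_radial hb0 hb1 hx ht hx1 (by simp [hy1]))]
  simp [dY, lineDeriv]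

theorem dX_one_sprayCoeff_one_radial {b : ℝ} (hb0 : 0 < b) (hb1 : b < 1) {x y : Fin 2 → ℝ}
    (hx : x ∈ puncturedDisc) (hy : y ≠ 0) (hx1 : x 1 = 0) (hy1 : y 1 = 0) :
    dX 1 (sprayCoeff (metric b) 1) x y = -y 0 ^ 2 / conf x := by
  have hp := (conf_pos hx).ne'
  -- This line leaves the axis `x 1 = 0`, but `y 1 = 0` still removes the projective term.
  rw [dX_congr isOpen_puncturedDisc 1 hx
    (Ψ := fun x y => -y 0 ^ 2 * x 1 / conf x)
    (fun _ ht => by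
      rw [sprayCoeff_metric hb0 hb1 ht hy, poincareSpray, nrm_sq_radial hy1, hy1]; ring)]
  refine HasLineDerivAt.lineDeriv ?_
  have h1 := HasDerivAt.div (HasDerivAt.const_mul (-y 0 ^ 2) (hasLineDerivAt_coord x (𝐞 1) 1))
    (hasLineDerivAt_conf x (𝐞 1)) (by simpa using hp)
  refine HasDerivAt.congr_deriv h1 ?_
  simp [hx1, dot]
  field_simp

theorem dX_dY_sprayCoeff_radial {b : ℝ} (hb0 : 0 < b) (hb1 : b < 1) {x y : Fin 2 → ℝ}
    (hx : x ∈ puncturedDisc) (hy : y ≠ 0) (hx1 : x 1 = 0) (hy1 : y 1 = 0) :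
    dX 0 (dY 1 (sprayCoeff (metric b) 1)) x y =
      2 * y 0 * (1 + x 0 ^ 2) / conf x ^ 2 := by
  have hp := (conf_pos hx).ne'
  rw [dX_congr isOpen_puncturedDisc 0 hx (Ψ := fun x y => 2 * x 0 * y 0 / conf x)
    (fun _ ht => dY_one_sprayCoeff_one_radial hb0 hb1 ht hy (by simp [hx1]) hy1)]
  refine HasLineDerivAt.lineDeriv ?_
  have h1 := HasDerivAt.div
    (HasDerivAt.mul_const (HasDerivAt.const_mul 2 (hasLineDerivAt_coord x (𝐞 0) 0)) (y 0))
    (hasLineDerivAt_conf x (𝐞 0)) (by simpa using hp)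
  refine HasDerivAt.congr_deriv h1 ?_
  simp [hx1, dot, conf]
  ring

theorem dY_dY_sprayCoeff_radial {b : ℝ} (hb0 : 0 < b) (hb1 : b < 1) {x y : Fin 2 → ℝ}
    (hx : x ∈ puncturedDisc) (hy : y ≠ 0) (hx1 : x 1 = 0) (hy1 : y 1 = 0) :
    dY 0 (dY 1 (sprayCoeff (metric b) 1)) x y = 2 * x 0 / conf x := by
  rw [dY_congr isOpen_ne 0 hy (Ψ := fun x y => 2 * x 0 * y 0 / conf x)
    (fun _ ht => dY_one_sprayCoeff_one_radial hb0 hb1 hx ht hx1 (by simp [hy1]))]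
  refine HasLineDerivAt.lineDeriv ?_
  have h1 := HasDerivAt.div_const
    (HasDerivAt.const_mul (2 * x 0) (hasLineDerivAt_coord y (𝐞 0) 0)) (conf x)
  refine HasDerivAt.congr_deriv h1 ?_
  simp

theorem riemannCurvature_radial {b : ℝ} (hb0 : 0 < b) (hb1 : b < 1) {x y : Fin 2 → ℝ}
    (hx : x ∈ puncturedDisc) (hy : y ≠ 0) (hx1 : x 1 = 0) (hy1 : y 1 = 0) :
    riemannCurvature (metric b) 1 1 x y = -4 * y 0 ^ 2 / conf x ^ 2 := by
  have hp := (conf_pos hx).ne'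
  have hc : conf x = 1 - x 0 ^ 2 := by simp [conf, hx1]
  simp only [riemannCurvature, Fin.sum_univ_two,
    dX_one_sprayCoeff_one_radial hb0 hb1 hx hy hx1 hy1,
    dX_dY_sprayCoeff_radial hb0 hb1 hx hy hx1 hy1,
    dY_dY_sprayCoeff_radial hb0 hb1 hx hy hx1 hy1,
    dY_zero_sprayCoeff_one_radial hb0 hb1 hx hy hx1 hy1,
    dY_one_sprayCoeff_one_radial hb0 hb1 hx hy hx1 hy1,
    sprayCoeff_zero_radial hb0 hb1 hx hy hx1 hy1,
    sprayCoeff_one_radial hb0 hb1 hx hy hx1 hy1, hy1]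
  field_simp
  rw [hc]
  ring

/-! ### Radial flag curvature and the contradiction. -/

theorem metric_radial (b : ℝ) {x y : Fin 2 → ℝ} (hx0 : 0 < x 0) (hx1 : x 1 = 0)
    (hy1 : y 1 = 0) : metric b x y = (2 * |y 0| + b * y 0) / conf x := by
  rw [metric_eq]
  simp [nrm, dot, hx1, hy1, Real.sqrt_sq_eq_abs, abs_of_pos hx0, mul_div_cancel_left₀ _ hx0.ne']

/-- Along radial flagpoles the flag curvature is `-(α / F)²`. -/
theorem flagCurvature_radial {b : ℝ} (hb0 : 0 < b) (hb1 : b < 1) {x y : Fin 2 → ℝ}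
    (hx : x ∈ puncturedDisc) (hx0 : 0 < x 0) (hx1 : x 1 = 0) (hy0 : y 0 ≠ 0) (hy1 : y 1 = 0) :
    flagCurvature (metric b) x y ![0, 1] = -4 * y 0 ^ 2 / (2 * |y 0| + b * y 0) ^ 2 := by
  have hy : y ≠ 0 := fun h => hy0 (by simp [h])
  have hp := (conf_pos hx).ne'
  have hF := (metric_pos hb0 hb1 hx hy).ne'
  have hm : nrm y = |y 0| := by simp [nrm, hy1, Real.sqrt_sq_eq_abs]
  have hr : nrm x = x 0 := by simp [nrm, hx1, Real.sqrt_sq_eq_abs, abs_of_pos hx0]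
  have ha : |y 0| ≠ 0 := abs_ne_zero.2 hy0
  have h01 : fundamentalTensor (metric b) x y 0 1 = 0 := by
    rw [fundamentalTensor_metric b x hy]
    simp [metricY, metricYY, dot, hx1, hy1]
  have h10 : fundamentalTensor (metric b) x y 1 0 = 0 := by
    rw [fundamentalTensor_metric b x hy]
    simp [metricY, metricYY, dot, hx1, hy1]
  -- Euler's identity `g_y(y, y) = F²` for radial `y`.
  have h00 : fundamentalTensor (metric b) x y 0 0 * y 0 ^ 2 = metric b x y ^ 2 := by
    rw [fundamentalTensor_metric b x hy, metric_radial b hx0 hx1 hy1]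
    have : y 0 / |y 0| * y 0 = |y 0| := by
      rw [div_mul_eq_mul_div, ← sq, ← sq_abs, sq, mul_div_cancel_right₀ _ ha]
    have h' : y 0 * y 0 / |y 0| ^ 3 = 1 / |y 0| := by
      rw [← sq, ← sq_abs]; field_simp
    simp only [metricY, metricYY, dot, hx1, hy1, hm, hr, Pi.single_eq_same, mul_one, zero_mul,
      add_zero, h', div_self hx0.ne']
    simp only [ne_eq, one_ne_zero, not_false_eq_true, Pi.single_eq_of_ne, mul_zero, add_zero,
      sub_self, zero_div]
    generalize y 0 / |y 0| = q at this ⊢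
    rw [← this]
    ring
  -- `g` is diagonal here, so `g₁₁ ≠ 0`; it cancels from the quotient defining the flag curvature.
  have hdet := det_fundamentalTensor_ne_zero hb0 hb1 hx hy
  rw [Matrix.det_fin_two, h01, zero_mul, sub_zero] at hdet
  have h11 := right_ne_zero_of_mul hdet
  have hM := metric_radial b hx0 hx1 hy1
  have hN : 2 * |y 0| + b * y 0 ≠ 0 := fun h => hF (by rw [hM, h, zero_div])
  simp only [flagCurvature, fundamentalForm, Fin.sum_univ_two, h01, h10, hy1,
    riemannCurvature_radial hb0 hb1 hx hy hx1 hy1]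
  simp only [Matrix.cons_val_zero, Matrix.cons_val_one, mul_zero, zero_mul, add_zero, zero_add,
    mul_one]
  have h00' : fundamentalTensor (metric b) x y 0 0 * y 0 * y 0 =
      ((2 * |y 0| + b * y 0) / conf x) ^ 2 := by
    rw [← hM, ← h00]; ring
  rw [h00']
  generalize 2 * |y 0| + b * y 0 = N at hN
  field_simp
  ring

end RandersPoincare

end

theorem proposition1p2 (b : ℝ) (hb0 : 0 < b) (hb1 : b < 1) :
    ¬ ∃ K : ℝ, K < 0 ∧
      Finsler.HasConstantFlagCurvature (RandersPoincare.metric b)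
        RandersPoincare.puncturedDisc K := by
  rintro ⟨K, -, h⟩
  have hx : (![1 / 2, 0] : Fin 2 → ℝ) ∈ RandersPoincare.puncturedDisc := by
    refine ⟨by norm_num, fun h => ?_⟩
    have := congrFun h 0
    norm_num at this
  have hli : ∀ c : ℝ, c ≠ 0 → LinearIndependent ℝ ![(![c, 0] : Fin 2 → ℝ), ![0, 1]] := by
    intro c hc
    rw [LinearIndependent.pair_iff]
    intro s t hst
    have h0 := congrFun hst 0
    have h1 := congrFun hst 1
    simp [hc] at h0 h1
    exact ⟨h0, h1⟩
  have hout := h _ hx ![1, 0] ![0, 1] (hli 1 one_ne_zero)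
  have hin := h _ hx ![-1, 0] ![0, 1] (hli (-1) (by norm_num))
  rw [RandersPoincare.flagCurvature_radial hb0 hb1 hx (by norm_num) (by simp) (by simp)
    (by simp)] at hout hin
  rw [← hin] at hout
  -- Equality of `-4/(2 + b)²` and `-4/(2 - b)²` forces `8b = 0`.
  have h2 : 2 - b ≠ 0 := by linarith
  have h3 : 2 + b ≠ 0 := by linarith
  simp [← sub_eq_add_neg] at hout
  field_simp at hout
  nlinarith
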